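/- Let $R$ be a commutative ring and $x,y\in R$. On the square lattice $\mathbb{Z}^2$ give every edge $(p,q)\to(p+1,q)$ weight $x$ and every edge $(p,q)\to(p,q+1)$ weight $y$; the triangular lattice has in addition the edges $(p,q)\to(p+1,q+1)$, of weight $z$. The weight of a path is the product of the weights of its edges (a path of length zero has weight $1$), and the weight of a pair of paths is the product of the two weights. The total weight of a finite set of paths, or of pairs of paths, is the sum of the weights of its members. Let $a,c\in\mathbb{Z}_{>0}$, $b\in\mathbb{Z}_{\ge 0}$, and let $u_1=(0,0)$, $u_2=(a,a)$, $v_1=(a+b,a+b)$, $v_2=(a+b+c,a+b+c)$. Let $\mathscr{N}_0(a,b,c)$ be the set of pairs $(p_1,p_2)$ of directed paths on the triangular lattice without a common vertex (end points included) such that, for some permutation $\pi$ of $\{1,2\}$, $p_i$ goes from $u_i$ to $v_{\pi(i)}$ for $i=1,2$. Then the total weight of the pairs in $\mathscr{N}_0(a,b,c)$ whose paths both lie on the square lattice equals $\mathrm{wt}(\mathscr{N}_0(a,b,c))|_{z=0}$, and it is equal to $$2\,xy\,\mathrm{wt}(\mathscr{B}_{b,b})\sum_{i=1}^{a}\sum_{j=1}^{c}\mathrm{wt}(\mathscr{C}_{b+i+j-1})\,\mathrm{wt}(\mathscr{B}_{a-i,a-i})\,\mathrm{wt}(\mathscr{B}_{c-j,c-j}).$$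 Here $\mathrm{wt}(\mathscr{B}_{n,k})$, the weighted binomial coefficient, is the total weight of the square lattice paths from $(0,0)$ to $(n,k)$, and $\mathrm{wt}(\mathscr{C}_n)$, the weighted Catalan number, is the total weight of the square lattice paths from $(0,0)$ to $(n,n)$ that never pass below the line $y=x$. For all $n,k\ge 0$ they are given explicitly by $$\mathrm{wt}(\mathscr{B}_{n,k})=\binom{n+k}{k}x^{n}y^{k},\qquad \mathrm{wt}(\mathscr{C}_n)=\frac{1}{n+1}\binom{2n}{n}x^ny^n.$$ -/

import Mathlib

namespace LatticePaths

/-- The steps of the square lattice: east `(1,0)` and north `(0,1)`. -/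
def squareSteps : Finset (ℤ × ℤ) := {(1, 0), (0, 1)}

/-- The steps of the triangular lattice: `(1,0)`, `(0,1)` and `(1,1)`. -/
def triSteps : Finset (ℤ × ℤ) := {(1, 0), (0, 1), (1, 1)}

/-- A list of steps `l` is a lattice path from `u` to `v` with steps in `S`. The empty list is the
path of length zero. -/
def IsPath (S : Finset (ℤ × ℤ)) (u v : ℤ × ℤ) (l : List (ℤ × ℤ)) : Prop :=
  (∀ s ∈ l, s ∈ S) ∧ u + l.sum = v

theorem length_le_of_steps (l : List (ℤ × ℤ)) (h : ∀ s ∈ l, s ∈ triSteps) :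
    (l.length : ℤ) ≤ l.sum.1 + l.sum.2 := by
  induction l with
  | nil => simp
  | cons s l ih =>
    have h1 := ih (fun t ht => h t (List.mem_cons_of_mem _ ht))
    have h2 := h s List.mem_cons_self
    simp only [triSteps, Finset.mem_insert, Finset.mem_singleton] at h2
    simp only [List.length_cons, List.sum_cons, Prod.fst_add, Prod.snd_add, Nat.cast_add,
      Nat.cast_one]
    rcases h2 with rfl | rfl | rfl <;> simp only <;> omega

theorem finite_isPath (S : Finset (ℤ × ℤ)) (hS : S ⊆ triSteps) (u v : ℤ × ℤ) :
    {l | IsPath S u v l}.Finite := by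
  refine ((List.finite_length_le S ((v - u).1 + (v - u).2).toNat).image
    (List.map Subtype.val)).subset ?_
  rintro l ⟨h1, h2⟩
  have h3 := length_le_of_steps l (fun s hs => hS (h1 s hs))
  have h4 : l.sum = v - u := by rw [← h2]; abel
  rw [h4] at h3
  refine ⟨l.attach.map (fun s => ⟨s.1, h1 s.1 s.2⟩), ?_, ?_⟩
  · simp only [Set.mem_ofPred_eq, List.length_map, List.length_attach]
    omega
  · rw [List.map_map]
    exact List.attach_map_subtype_val l

/-- The finite set of all paths from `u` to `v` on the square lattice. -/
noncomputable def squarePaths (u v : ℤ × ℤ) : Finset (List (ℤ × ℤ)) :=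
  (finite_isPath squareSteps (by decide) u v).toFinset

/-- The finite set of all paths from `u` to `v` on the triangular lattice. -/
noncomputable def triPaths (u v : ℤ × ℤ) : Finset (List (ℤ × ℤ)) :=
  (finite_isPath triSteps (by decide) u v).toFinset

theorem mem_squarePaths {u v : ℤ × ℤ} {l : List (ℤ × ℤ)} :
    l ∈ squarePaths u v ↔ IsPath squareSteps u v l := by
  simp [squarePaths]

theorem mem_triPaths {u v : ℤ × ℤ} {l : List (ℤ × ℤ)} :
    l ∈ triPaths u v ↔ IsPath triSteps u v l := by
  simp [triPaths]

/-- The vertices visited by the path that starts at `u` and has steps `l`, both ends included. -/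
def vertices (u : ℤ × ℤ) (l : List (ℤ × ℤ)) : List (ℤ × ℤ) := l.scanl (· + ·) u

section Weights

variable {R : Type*} [CommRing R]

/-- Weight of an edge: `x` for `(1,0)`, `y` for `(0,1)`, `z` for `(1,1)`. -/
def triEdgeWeight (x y z : R) (s : ℤ × ℤ) : R :=
  if s = (1, 0) then x else if s = (0, 1) then y else if s = (1, 1) then z else 0

/-- Weight of an edge of the square lattice: `x` for `(1,0)`, `y` for `(0,1)`. -/
def squareEdgeWeight (x y : R) (s : ℤ × ℤ) : R :=
  if s = (1, 0) then x else if s = (0, 1) then y else 0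

/-- Weight of a path: the product of the weights of its edges. -/
def pathWeight (w : ℤ × ℤ → R) (l : List (ℤ × ℤ)) : R := (l.map w).prod

/-- Families `(p₁, …, pₙ)` of pairwise vertex-disjoint paths with connection type `π`: `pᵢ` is one
of the given `paths` from `uᵢ` to `v_{π(i)}`. -/
def nonIntersecting {n : ℕ} (paths : ℤ × ℤ → ℤ × ℤ → Finset (List (ℤ × ℤ)))
    (u v : Fin n → ℤ × ℤ) (π : Equiv.Perm (Fin n)) : Finset (Fin n → List (ℤ × ℤ)) :=
  (Fintype.piFinset fun i => paths (u i) (v (π i))).filter fun p =>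
    ∀ i j, i ≠ j → ∀ q ∈ vertices (u i) (p i), q ∉ vertices (u j) (p j)

/-- Total weight of all families of non-intersecting paths connecting `{u₁, …, uₙ}` to
`{v₁, …, vₙ}`, over all connection types. -/
def nonIntersectingWeight {n : ℕ} (paths : ℤ × ℤ → ℤ × ℤ → Finset (List (ℤ × ℤ)))
    (w : ℤ × ℤ → R) (u v : Fin n → ℤ × ℤ) : R :=
  ∑ π : Equiv.Perm (Fin n), ∑ p ∈ nonIntersecting paths u v π, ∏ i, pathWeight w (p i)

/-- The starting points `u₁ = (0,0)` and `u₂ = (a,a)`. -/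
def startPoints (a : ℕ) : Fin 2 → ℤ × ℤ := ![(0, 0), ((a : ℤ), (a : ℤ))]

/-- The ending points `v₁ = (a+b,a+b)` and `v₂ = (a+b+c,a+b+c)`. -/
def endPoints (a b c : ℕ) : Fin 2 → ℤ × ℤ :=
  ![((a : ℤ) + b, (a : ℤ) + b), ((a : ℤ) + b + c, (a : ℤ) + b + c)]

/-- Total weight of the non-intersecting pairs of paths on the triangular lattice. -/
noncomputable def triPairsWeight (x y z : R) (a b c : ℕ) : R :=
  nonIntersectingWeight triPaths (triEdgeWeight x y z) (startPoints a) (endPoints a b c)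

/-- Total weight of the non-intersecting pairs of paths on the square lattice. -/
noncomputable def squarePairsWeight (x y : R) (a b c : ℕ) : R :=
  nonIntersectingWeight squarePaths (squareEdgeWeight x y) (startPoints a) (endPoints a b c)

/-- Weighted binomial coefficient: total weight of the square lattice paths from `(0,0)` to
`(n,k)`. -/
noncomputable def wtB (x y : R) (n k : ℕ) : R :=
  ∑ l ∈ squarePaths (0, 0) ((n : ℤ), (k : ℤ)), pathWeight (squareEdgeWeight x y) l

/-- Weighted Catalan number: total weight of the square lattice paths from `(0,0)` to `(n,n)` that
never pass below the line `y = x`. -/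
noncomputable def wtC (x y : R) (n : ℕ) : R :=
  ∑ l ∈ (squarePaths (0, 0) ((n : ℤ), (n : ℤ))).filter
      (fun l => ∀ q ∈ vertices (0, 0) l, q.1 ≤ q.2),
    pathWeight (squareEdgeWeight x y) l

end Weights

/-- The division in the Catalan number `binom(2n,n) / (n+1)` is exact. -/
theorem succ_dvd_choose (n : ℕ) : n + 1 ∣ (2 * n).choose n :=
  Nat.succ_dvd_centralBinom n

end LatticePaths

namespace LatticePaths

/-! ### Decomposition of square lattice paths by their first step. -/

section Steps

/-! Square lattice paths with the same end points all have the same monomial weight, so the theorem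
reduces to counting: `squarePairsWeight` is the integer `numUnordered` times `(x * y) ^ (a + 2 * b +
c)`. Setting `z = 0` kills every path with a diagonal step, which settles the comparison with the
triangular lattice.

Put `k = a + b`, write `N` for `numPaths` and `A` for `signedAvoiding k c`, which is antisymmetric
under reflection in the diagonal. For starting points `u`, `u'` on one antidiagonal, `u` to the
lower right, the count over both connection types is the determinant `N(u',v₁) A(u) - N(u,v₁) A(u')`
(`numUnordered_antidiagonal`): both sides obey the same recursion when both paths take a step,
vanish when the starting points coincide, and agree on the antidiagonal of `v₁`. The sign carried by
`A` makes up for the two connection types being added rather than subtracted.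

With `u' = (a,a)` one has `A(u') = 0`, and the determinant becomes `N(u₂,v₁) |A|(u)`. Moving `u`
back to the origin (`numUnordered_to_diag`), `|A|` obeys the one-step recursion except on the
diagonal, where the defect is `2 A(p+1,p)`; these defects give the sum over `i`, and expanding `A`
by the first return to the diagonal gives the sum over `j` and the Catalan numbers. Numerically, the
pairs are as many as those of an arbitrary path from `u₂` to `v₁` and a path from `u₁` to `v₂` that
avoids the diagonal between `u₂` and `v₁`. -/

theorem sum_nonneg_of_squareSteps {l : List (ℤ × ℤ)} (h : ∀ s ∈ l, s ∈ squareSteps) :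
    0 ≤ l.sum.1 ∧ 0 ≤ l.sum.2 := by
  induction l with
  | nil => simp
  | cons s l ih =>
    have h1 := ih (fun t ht => h t (List.mem_cons_of_mem _ ht))
    have h2 := h s List.mem_cons_self
    simp only [squareSteps, Finset.mem_insert, Finset.mem_singleton] at h2
    simp only [List.sum_cons, Prod.fst_add, Prod.snd_add]
    rcases h2 with rfl | rfl <;> simp only <;> omega

theorem le_of_mem_squarePaths {p q p' q' : ℤ} {l : List (ℤ × ℤ)}
    (h : l ∈ squarePaths (p, q) (p', q')) : p ≤ p' ∧ q ≤ q' := by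
  obtain ⟨h1, h2⟩ := mem_squarePaths.1 h
  have h3 := sum_nonneg_of_squareSteps h1
  rw [Prod.ext_iff] at h2
  simp only [Prod.fst_add, Prod.snd_add] at h2
  omega

theorem squarePaths_eq_empty {p q p' q' : ℤ} (h : p' < p ∨ q' < q) :
    squarePaths (p, q) (p', q') = ∅ := by
  refine Finset.eq_empty_of_forall_notMem fun l hl => ?_
  have := le_of_mem_squarePaths hl
  omega

theorem vertices_cons (u s : ℤ × ℤ) (l : List (ℤ × ℤ)) :
    vertices u (s :: l) = u :: vertices (u + s) l :=
  List.scanl_cons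

theorem le_of_mem_vertices {p q p' q' : ℤ} {l : List (ℤ × ℤ)} (h : ∀ s ∈ l, s ∈ squareSteps)
    (hq : (p', q') ∈ vertices (p, q) l) : p ≤ p' ∧ q ≤ q' := by
  induction l generalizing p q with
  | nil => simp_all [vertices]
  | cons s l ih =>
    have h2 := h s List.mem_cons_self
    simp only [squareSteps, Finset.mem_insert, Finset.mem_singleton] at h2
    simp only [vertices_cons, List.mem_cons, Prod.mk.injEq] at hq
    rcases hq with hq | hq
    · omega
    · rcases h2 with rfl | rfl <;>
      · have := ih (fun t ht => h t (List.mem_cons_of_mem _ ht)) hq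
        omega

theorem squarePaths_eq_union (p q : ℤ) (v : ℤ × ℤ) :
    squarePaths (p, q) v = (if (p, q) = v then {[]} else ∅) ∪
      ((squarePaths (p + 1, q) v).image (List.cons (1, 0)) ∪
        (squarePaths (p, q + 1) v).image (List.cons (0, 1))) := by
  ext l
  obtain ⟨p', q'⟩ := v
  rcases l with _ | ⟨s, l⟩
  · simp only [mem_squarePaths, IsPath, Finset.mem_union, Finset.mem_image]
    split_ifs with h <;> simp_all
  · simp only [Finset.mem_union, Finset.mem_image, mem_squarePaths, IsPath, List.cons.injEq]
    have h0 : (s :: l) ∉ (if (p, q) = (p', q') then {[]} else ∅ : Finset (List (ℤ × ℤ))) := by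
      split_ifs <;> simp
    rw [or_iff_right h0]
    simp only [List.forall_mem_cons, List.sum_cons, Prod.ext_iff, Prod.fst_add,
      Prod.snd_add]
    simp only [squareSteps, Finset.mem_insert, Finset.mem_singleton]
    constructor
    · rintro ⟨⟨rfl | rfl, h1⟩, h2, h3⟩
      · exact Or.inl ⟨l, ⟨h1, by simp only at *; omega⟩, by simp⟩
      · exact Or.inr ⟨l, ⟨h1, by simp only at *; omega⟩, by simp⟩
    · obtain ⟨s1, s2⟩ := s
      rintro (⟨l', ⟨h1, h2⟩, ⟨h3, h4⟩, rfl⟩ | ⟨l', ⟨h1, h2⟩, ⟨h3, h4⟩, rfl⟩) <;>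
        simp only at h2 h3 h4 <;> subst h3 h4
      · exact ⟨⟨Or.inl rfl, h1⟩, by simp only; omega⟩
      · exact ⟨⟨Or.inr rfl, h1⟩, by simp only; omega⟩

/-- Sorting paths by their first step. -/
theorem sum_squarePaths {M : Type*} [AddCommMonoid M] (g : List (ℤ × ℤ) → M) (p q : ℤ)
    (v : ℤ × ℤ) :
    ∑ l ∈ squarePaths (p, q) v, g l = (if (p, q) = v then g [] else 0) +
      (∑ l ∈ squarePaths (p + 1, q) v, g ((1, 0) :: l) +
        ∑ l ∈ squarePaths (p, q + 1) v, g ((0, 1) :: l)) := by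
  rw [squarePaths_eq_union, Finset.sum_union, Finset.sum_union, Finset.sum_image, Finset.sum_image]
  · split_ifs <;> simp
  · simp
  · simp
  · rw [Finset.disjoint_left]
    simp only [Finset.mem_image]
    rintro _ ⟨l, _, rfl⟩ ⟨l', _, h⟩
    simp at h
  · rw [Finset.disjoint_left]
    intro l hl
    split_ifs at hl
    · simp_all
    · simp at hl

end Steps

/-! ### Numbers of single paths: binomial and Catalan numbers. -/

section Counts

/-- The number of square lattice paths from `u` to `v`. -/
noncomputable def numPaths (u v : ℤ × ℤ) : ℤ := ∑ _l ∈ squarePaths u v, 1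

theorem numPaths_step {p q : ℤ} {v : ℤ × ℤ} (h : (p, q) ≠ v) :
    numPaths (p, q) v = numPaths (p + 1, q) v + numPaths (p, q + 1) v := by
  rw [numPaths, sum_squarePaths, if_neg h, zero_add]; rfl

theorem numPaths_eq_zero {p q p' q' : ℤ} (h : p' < p ∨ q' < q) :
    numPaths (p, q) (p', q') = 0 := by
  rw [numPaths, squarePaths_eq_empty h, Finset.sum_empty]

theorem numPaths_self (u : ℤ × ℤ) : numPaths u u = 1 := by
  obtain ⟨p, q⟩ := u
  rw [numPaths, sum_squarePaths, squarePaths_eq_empty (by omega), squarePaths_eq_empty (by omega)]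
  simp

theorem numPaths_add (p q : ℤ) (n k : ℕ) :
    numPaths (p, q) (p + n, q + k) = ((n + k).choose k : ℕ) := by
  induction hN : n + k generalizing p q n k with
  | zero =>
    obtain ⟨rfl, rfl⟩ : n = 0 ∧ k = 0 := by omega
    simp [numPaths_self]
  | succ N ih =>
    rw [numPaths_step (by simp only [ne_eq, Prod.mk.injEq]; omega)]
    rcases n with _ | n
    · rcases k with _ | k
      · omega
      rw [numPaths_eq_zero (by simp), show q + ((k + 1 : ℕ) : ℤ) = q + 1 + k by push_cast; ring,
        ih _ _ 0 k (by omega)]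
      obtain rfl : N = k := by omega
      simp
    · rw [show p + ((n + 1 : ℕ) : ℤ) = p + 1 + n by push_cast; ring, ih _ _ n k (by omega)]
      rcases k with _ | k
      · rw [numPaths_eq_zero (by simp)]
        simp
      · rw [show p + 1 + (n : ℤ) = p + (n + 1 : ℕ) by push_cast; ring,
          show q + ((k + 1 : ℕ) : ℤ) = q + 1 + k by push_cast; ring, ih _ _ (n + 1) k (by omega),
          Nat.choose_succ_succ N k]
        push_cast
        ring

/-- Invariance under the reflection in the line `x - y = d`, read off from the symmetry of binomial
coefficients. -/
theorem numPaths_swap_add (p q p' q' d : ℤ) :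
    numPaths (q + d, p - d) (q' + d, p' - d) = numPaths (p, q) (p', q') := by
  by_cases h : p ≤ p' ∧ q ≤ q'
  · obtain ⟨n, hn⟩ := Int.eq_ofNat_of_zero_le (sub_nonneg.2 h.1)
    obtain ⟨k, hk⟩ := Int.eq_ofNat_of_zero_le (sub_nonneg.2 h.2)
    rw [show p' = p + n by omega, show q' = q + k by omega, numPaths_add,
      show q + (k : ℤ) + d = q + d + k by ring, show p + (n : ℤ) - d = p - d + n by ring,
      numPaths_add, add_comm k n, Nat.choose_symm_add]
  · rw [numPaths_eq_zero (by omega), numPaths_eq_zero (by omega)]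

theorem numPaths_swap (p q p' q' : ℤ) :
    numPaths (q, p) (q', p') = numPaths (p, q) (p', q') := by
  simpa using numPaths_swap_add p q p' q' 0

/-- The number of square lattice paths from `u` to `v` that never pass below `y = x`. -/
noncomputable def numAbove (u v : ℤ × ℤ) : ℤ :=
  ∑ l ∈ squarePaths u v, if ∀ q ∈ vertices u l, q.1 ≤ q.2 then 1 else 0

theorem numAbove_of_lt {p q : ℤ} (v : ℤ × ℤ) (h : q < p) : numAbove (p, q) v = 0 := by
  refine Finset.sum_eq_zero fun l _ => if_neg fun hl => ?_
  have := hl (p, q) (by cases l <;> simp [vertices])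
  simp only at this
  omega

theorem numAbove_step {p q : ℤ} {v : ℤ × ℤ} (hv : (p, q) ≠ v) (h : p ≤ q) :
    numAbove (p, q) v = numAbove (p + 1, q) v + numAbove (p, q + 1) v := by
  rw [numAbove, sum_squarePaths, if_neg hv, zero_add]
  congr 1 <;>
  · refine Finset.sum_congr rfl fun l _ => if_congr ?_ rfl rfl
    simp only [vertices_cons, List.forall_mem_cons, Prod.mk_add_mk, add_zero]
    exact and_iff_right h

theorem numAbove_self {p q : ℤ} (h : p ≤ q) : numAbove (p, q) (p, q) = 1 := by
  rw [numAbove, sum_squarePaths, squarePaths_eq_empty (by omega), squarePaths_eq_empty (by omega)]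
  simp [vertices, h]

/-- The reflection principle for the paths above the diagonal. -/
theorem numAbove_eq (n : ℤ) (t : ℕ) (p q : ℤ) (ht : p + q + t = 2 * n) (h : p ≤ q + 1) :
    numAbove (p, q) (n, n) = numPaths (p, q) (n, n) - numPaths (p, q) (n + 1, n - 1) := by
  induction t generalizing p q with
  | zero =>
    by_cases hp : p = n
    · obtain rfl : q = n := by push_cast at ht; omega
      subst hp
      rw [numAbove_self le_rfl, numPaths_self, numPaths_eq_zero (by omega), sub_zero]
    · rw [numPaths_eq_zero (by push_cast at ht; omega),
        numPaths_eq_zero (by push_cast at ht; omega), numAbove,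
        squarePaths_eq_empty (by push_cast at ht; omega), Finset.sum_empty, sub_zero]
  | succ t ih =>
    push_cast at ht
    rcases h.lt_or_eq with h | rfl
    · rw [numAbove_step (by simp only [ne_eq, Prod.mk.injEq]; omega) (by omega),
        numPaths_step (by simp only [ne_eq, Prod.mk.injEq]; omega),
        numPaths_step (v := (n + 1, n - 1)) (by simp only [ne_eq, Prod.mk.injEq]; omega),
        ih _ _ (by omega) (by omega), ih _ _ (by omega) (by omega)]
      ring
    -- The starting point lies on the mirror `x - y = 1`, which exchanges `(n, n)` and `(n + 1, n -
    -- 1)`, so the two path counts cancel.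
    · rw [numAbove_of_lt _ (by omega)]
      have := numPaths_swap_add (q + 1) q n n 1
      simp only [add_sub_cancel_right] at this
      rw [this, sub_self]

theorem numPaths_sub_eq_catalan (p q : ℤ) (n : ℕ) :
    numPaths (p, q) (p + n, q + n) - numPaths (p, q) (p + n + 1, q + n - 1)
      = ((2 * n).choose n / (n + 1) : ℕ) := by
  have hc := catalan_eq_centralBinom_div n
  rw [Nat.centralBinom] at hc
  rw [← hc, numPaths_add, ← two_mul]
  rcases n with _ | n
  · rw [numPaths_eq_zero (by simp)]; simp
  · rw [show p + ((n + 1 : ℕ) : ℤ) + 1 = p + (n + 2 : ℕ) by push_cast; ring,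
      show q + ((n + 1 : ℕ) : ℤ) - 1 = q + n by push_cast; ring, numPaths_add]
    have h1 := succ_mul_catalan_eq_centralBinom (n + 1)
    have h2 := Nat.choose_succ_right_eq (2 * (n + 1)) n
    rw [Nat.centralBinom] at h1
    rw [show 2 * (n + 1) - n = n + 2 by omega] at h2
    rw [show n + 2 + n = 2 * (n + 1) by ring]
    have h3 : ((n : ℤ) + 2) ≠ 0 := by positivity
    apply mul_left_cancel₀ h3
    zify at h1 h2
    linear_combination h2 - h1

theorem numAbove_diag (n : ℕ) :
    numAbove (0, 0) (n, n) = ((2 * n).choose n / (n + 1) : ℕ) := by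
  rw [numAbove_eq n (2 * n) 0 0 (by push_cast; ring) (by norm_num), ← numPaths_sub_eq_catalan 0 0 n]
  simp

end Counts

/-! ### Recursions for pairs of disjoint paths. -/

section Pairs

/-- The number of pairs of paths without a common vertex, from `u` to `v` and from `u'` to `v'`. -/
noncomputable def numPairs (u u' v v' : ℤ × ℤ) : ℤ :=
  ∑ l ∈ squarePaths u v, ∑ l' ∈ squarePaths u' v',
    if ∀ q ∈ vertices u l, q ∉ vertices u' l' then 1 else 0

theorem numPairs_comm (u u' v v' : ℤ × ℤ) : numPairs u u' v v' = numPairs u' u v' v := by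
  rw [numPairs, Finset.sum_comm]
  refine Finset.sum_congr rfl fun l _ => Finset.sum_congr rfl fun l' _ => if_congr ?_ rfl rfl
  exact ⟨fun h q hq hq' => h q hq' hq, fun h q hq hq' => h q hq' hq⟩

theorem self_mem_vertices (u : ℤ × ℤ) (l : List (ℤ × ℤ)) : u ∈ vertices u l := by
  cases l <;> simp [vertices]

theorem numPairs_self (u v v' : ℤ × ℤ) : numPairs u u v v' = 0 :=
  Finset.sum_eq_zero fun _ _ => Finset.sum_eq_zero fun _ _ =>
    if_neg fun h => h u (self_mem_vertices _ _) (self_mem_vertices _ _)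

theorem notMem_vertices {p q p' q' : ℤ} {v : ℤ × ℤ} {l : List (ℤ × ℤ)}
    (hl : l ∈ squarePaths (p', q') v) (h : p + q ≤ p' + q') (hne : p ≠ p' ∨ q ≠ q') :
    (p, q) ∉ vertices (p', q') l := fun hm => by
  have := le_of_mem_vertices (mem_squarePaths.1 hl).1 hm
  omega

/-- The other path starts at a different point on the same or a later antidiagonal, so it can never
visit `(p, q)`; deleting this vertex does not affect disjointness. -/
theorem numPairs_step {p q p' q' : ℤ} {v : ℤ × ℤ} (v' : ℤ × ℤ) (hv : (p, q) ≠ v)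
    (h : p + q ≤ p' + q') (hne : p ≠ p' ∨ q ≠ q') :
    numPairs (p, q) (p', q') v v' =
      numPairs (p + 1, q) (p', q') v v' + numPairs (p, q + 1) (p', q') v v' := by
  rw [numPairs, sum_squarePaths, if_neg hv, zero_add]
  congr 1 <;>
  · refine Finset.sum_congr rfl fun l _ => Finset.sum_congr rfl fun l' hl' => if_congr ?_ rfl rfl
    simp only [vertices_cons, List.forall_mem_cons, Prod.mk_add_mk, add_zero]
    exact and_iff_right (notMem_vertices hl' h hne)

theorem numPairs_of_eq {p q p' q' : ℤ} (v' : ℤ × ℤ)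
    (h : p + q ≤ p' + q') (hne : p ≠ p' ∨ q ≠ q') :
    numPairs (p, q) (p', q') (p, q) v' = numPaths (p', q') v' := by
  rw [numPairs, sum_squarePaths, squarePaths_eq_empty (p := p + 1) (by omega),
    squarePaths_eq_empty (p := p) (q := q + 1) (by omega)]
  simp only [if_true, Finset.sum_empty, add_zero]
  refine Finset.sum_congr rfl fun l' hl' => if_pos ?_
  simpa [vertices] using notMem_vertices hl' h hne

theorem numPairs_eq_zero {p q p' q' : ℤ} (u' v' : ℤ × ℤ) (h : p' < p ∨ q' < q) :
    numPairs (p, q) u' (p', q') v' = 0 := by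
  rw [numPairs, squarePaths_eq_empty h, Finset.sum_empty]

/-- The number of pairs of paths without a common vertex from `u`, `u'` to `v`, `v'`, in any
order. -/
noncomputable def numUnordered (u u' v v' : ℤ × ℤ) : ℤ :=
  numPairs u u' v v' + numPairs u u' v' v

theorem numUnordered_comm (u u' v v' : ℤ × ℤ) :
    numUnordered u u' v v' = numUnordered u' u v v' := by
  rw [numUnordered, numUnordered, numPairs_comm u, numPairs_comm u, add_comm]

theorem numUnordered_self (u v v' : ℤ × ℤ) : numUnordered u u v v' = 0 := by
  rw [numUnordered, numPairs_self, numPairs_self, add_zero]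

theorem numUnordered_step {p q p' q' : ℤ} {v v' : ℤ × ℤ} (hv : p + q < v.1 + v.2)
    (hv' : p + q < v'.1 + v'.2) (h : p + q ≤ p' + q') (hne : p ≠ p' ∨ q ≠ q') :
    numUnordered (p, q) (p', q') v v' =
      numUnordered (p + 1, q) (p', q') v v' + numUnordered (p, q + 1) (p', q') v v' := by
  rw [numUnordered, numPairs_step v' (by rintro rfl; simp at hv) h hne,
    numPairs_step v (by rintro rfl; simp at hv') h hne, numUnordered, numUnordered]
  ring

/-- After the first path has moved, the second start lags one antidiagonal behind, so the one-step
recursion applies to it by symmetry. -/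
theorem numUnordered_step_both {p q p' q' : ℤ} {v v' : ℤ × ℤ} (hv : p + q < v.1 + v.2)
    (hv' : p + q < v'.1 + v'.2) (h : p + q = p' + q') (hne : p ≠ p') :
    numUnordered (p, q) (p', q') v v' =
      numUnordered (p + 1, q) (p' + 1, q') v v' + numUnordered (p + 1, q) (p', q' + 1) v v' +
      (numUnordered (p, q + 1) (p' + 1, q') v v' + numUnordered (p, q + 1) (p', q' + 1) v v') := by
  have key (w : ℤ × ℤ) (hw : w = (p + 1, q) ∨ w = (p, q + 1)) :
      numUnordered w (p', q') v v' =
        numUnordered w (p' + 1, q') v v' + numUnordered w (p', q' + 1) v v' := by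
    rw [numUnordered_comm, numUnordered_comm w, numUnordered_comm w]
    rcases hw with rfl | rfl <;> exact numUnordered_step (by omega) (by omega) (by omega) (by omega)
  rw [numUnordered_step hv hv' h.le (Or.inl hne), key _ (Or.inl rfl), key _ (Or.inr rfl)]

end Pairs

/-! ### Signed counts, the determinant, and the return to the origin. -/

section Reflection

/-- The signed number of paths from `u` that reach the diagonal for the first time at `(m, m)`,
positive below the diagonal and negative above. -/
noncomputable def signedFirstHit (m : ℤ) (u : ℤ × ℤ) : ℤ :=
  numPaths u (m, m - 1) - numPaths u (m - 1, m)

theorem signedFirstHit_swap (m p q : ℤ) :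
    signedFirstHit m (q, p) = -signedFirstHit m (p, q) := by
  rw [signedFirstHit, signedFirstHit, numPaths_swap p q (m - 1) m, numPaths_swap p q m (m - 1)]
  ring

theorem signedFirstHit_diag (m p : ℤ) : signedFirstHit m (p, p) = 0 := by
  have := signedFirstHit_swap m p p
  omega

theorem signedFirstHit_step {m p q : ℤ} (h : (p, q) ≠ (m, m - 1)) (h' : (p, q) ≠ (m - 1, m)) :
    signedFirstHit m (p, q) = signedFirstHit m (p + 1, q) + signedFirstHit m (p, q + 1) := by
  rw [signedFirstHit, numPaths_step h, numPaths_step h', signedFirstHit, signedFirstHit]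
  ring

theorem signedFirstHit_eq_zero {m p q : ℤ} (h : 2 * m ≤ p + q) : signedFirstHit m (p, q) = 0 := by
  rw [signedFirstHit, numPaths_eq_zero (by omega), numPaths_eq_zero (by omega), sub_zero]

/-- An excursion from `(m, m)` to its first return loses its first and last steps, leaving a Catalan
path of semilength `n`; after a swap this is the same difference of binomials as before. -/
theorem signedFirstHit_catalan (m : ℤ) (n : ℕ) :
    signedFirstHit (m + n + 1) (m + 1, m) = ((2 * n).choose n / (n + 1) : ℕ) := by
  rw [← numPaths_sub_eq_catalan m (m + 1) n, signedFirstHit,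
    numPaths_swap m (m + 1) (m + n + 1 - 1) (m + n + 1), numPaths_swap m (m + 1) (m + n + 1) _]
  congr 2 <;> congr 1 <;> ring

/-- The signed number of paths from `u` to `(k + c, k + c)` that avoid the diagonal up to
`(k, k)`. -/
noncomputable def signedAvoiding (k : ℤ) (c : ℕ) (u : ℤ × ℤ) : ℤ :=
  ∑ j ∈ Finset.Icc 1 c,
    signedFirstHit (k + j) u * numPaths (k + j, k + j) (k + c, k + c)

variable {k : ℤ} {c : ℕ}

theorem signedAvoiding_swap (k : ℤ) (c : ℕ) (p q : ℤ) :
    signedAvoiding k c (q, p) = -signedAvoiding k c (p, q) := by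
  rw [signedAvoiding, signedAvoiding, ← Finset.sum_neg_distrib]
  exact Finset.sum_congr rfl fun j _ => by rw [signedFirstHit_swap, neg_mul]

theorem signedAvoiding_diag (k : ℤ) (c : ℕ) (p : ℤ) : signedAvoiding k c (p, p) = 0 :=
  Finset.sum_eq_zero fun j _ => by rw [signedFirstHit_diag, zero_mul]

theorem signedAvoiding_step {p q : ℤ} (h : p + q < 2 * k) :
    signedAvoiding k c (p, q) = signedAvoiding k c (p + 1, q) + signedAvoiding k c (p, q + 1) := by
  simp only [signedAvoiding]
  rw [← Finset.sum_add_distrib]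
  refine Finset.sum_congr rfl fun j hj => ?_
  have := (Finset.mem_Icc.1 hj).1
  rw [signedFirstHit_step, add_mul] <;> simp only [ne_eq, Prod.mk.injEq] <;> omega

/-- Decomposition by the first vertex on the diagonal. -/
theorem numPaths_eq_signedAvoiding (t : ℕ) {p q : ℤ} (ht : p + q + t = 2 * (k + c))
    (h : 2 * k ≤ p + q) (hpq : q < p) :
    numPaths (p, q) (k + c, k + c) = signedAvoiding k c (p, q) := by
  induction t generalizing p q with
  | zero =>
    push_cast at ht
    rw [numPaths_eq_zero (by omega), signedAvoiding, Finset.sum_eq_zero]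
    intro j hj
    have := (Finset.mem_Icc.1 hj).2
    rw [signedFirstHit_eq_zero (by omega), zero_mul]
  | succ t ih =>
    push_cast at ht
    rw [numPaths_step (by simp only [ne_eq, Prod.mk.injEq]; omega), ih (by omega) (by omega)
      (by omega)]
    by_cases hd : p = q + 1
    · subst hd
      -- A north step from `(q + 1, q)` hits the diagonal at once, at `(k + j, k + j)` with `j = q +
      -- 1 - k`; this term is split off, and the others come from the east step.
      have hmem : (q + 1 - k).toNat ∈ Finset.Icc 1 c := by rw [Finset.mem_Icc]; omega
      have hcast : k + ((q + 1 - k).toNat : ℤ) = q + 1 := by omega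
      simp only [signedAvoiding]
      rw [← Finset.add_sum_erase _ _ hmem, ← Finset.add_sum_erase _ _ hmem, hcast,
        signedFirstHit_eq_zero (by omega)]
      rw [show signedFirstHit (q + 1) (q + 1, q) = 1 by
        rw [signedFirstHit, add_sub_cancel_right, numPaths_self, numPaths_eq_zero (by omega),
          sub_zero]]
      rw [Finset.sum_congr rfl fun j hj => ?_]
      · ring
      · have hj' := (Finset.mem_erase.1 hj).1
        rw [signedFirstHit_step (p := q + 1), signedFirstHit_diag, add_zero] <;>
          simp only [ne_eq, Prod.mk.injEq] <;> omega
    · rw [ih (by omega) (by omega) (by omega)]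
      simp only [signedAvoiding]
      rw [← Finset.sum_add_distrib]
      refine Finset.sum_congr rfl fun j hj => ?_
      rw [signedFirstHit_step (p := p) (q := q), add_mul] <;> simp only [ne_eq, Prod.mk.injEq] <;> omega

/-- On the antidiagonal of `(k, k)`, one start must be `(k, k)` itself, with an empty path, and the
other path is then unconstrained. If that other start is above the diagonal, reflection produces the
minus sign of the determinant. -/
theorem numUnordered_last {p q e : ℤ} (h : p + q = 2 * k) (he : 0 < e) :
    numUnordered (p, q) (p - e, q + e) (k, k) (k + c, k + c) =
      numPaths (p - e, q + e) (k, k) * signedAvoiding k c (p, q) -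
        numPaths (p, q) (k, k) * signedAvoiding k c (p - e, q + e) := by
  rw [numUnordered]
  by_cases hp : p = k
  · subst hp
    obtain rfl : q = p := by omega
    rw [numPairs_of_eq _ (by omega) (by omega), numPairs_comm,
      numPairs_eq_zero _ _ (by omega), numPaths_self, numPaths_eq_zero (p' := q) (by omega),
      ← numPaths_swap, numPaths_eq_signedAvoiding (2 * c) (by push_cast; omega) (by omega)
      (by omega), signedAvoiding_swap]
    ring
  · rw [numPairs_eq_zero _ _ (by omega), numPaths_eq_zero (p := p) (p' := k) (by omega)]
    by_cases hq : p - e = k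
    · have hq' : q + e = k := by omega
      rw [hq, hq', numPairs_comm, numPairs_of_eq _ (by omega) (by omega), numPaths_self,
        numPaths_eq_signedAvoiding (2 * c) (by push_cast; omega) (by omega) (by omega)]
      ring
    · rw [numPairs_comm, numPairs_eq_zero _ _ (by omega),
        numPaths_eq_zero (p := p - e) (p' := k) (by omega)]
      ring

/-- Determinantal formula for starting points on a common antidiagonal. -/
theorem numUnordered_antidiagonal (hc : 0 < c) (t : ℕ) {p q e : ℤ} (ht : p + q + t = 2 * k)
    (he : 0 ≤ e) :
    numUnordered (p, q) (p - e, q + e) (k, k) (k + c, k + c) =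
      numPaths (p - e, q + e) (k, k) * signedAvoiding k c (p, q) -
        numPaths (p, q) (k, k) * signedAvoiding k c (p - e, q + e) := by
  induction t generalizing p q e with
  | zero =>
    rcases he.eq_or_lt with rfl | he
    · simp [numUnordered_self]
    · exact numUnordered_last (by simpa using ht) he
  | succ t ih =>
    rcases he.eq_or_lt with rfl | he
    · simp [numUnordered_self]
    push_cast at ht
    -- The offset `e` changes by at most one, so from `e > 0` it cannot become negative: the paths
    -- cannot cross without meeting at `e = 0`.
    have h1 := ih (p := p + 1) (q := q) (e := e) (by omega) he.le
    have h2 := ih (p := p + 1) (q := q) (e := e + 1) (by omega) (by omega)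
    have h3 := ih (p := p) (q := q + 1) (e := e - 1) (by omega) (by omega)
    have h4 := ih (p := p) (q := q + 1) (e := e) (by omega) he.le
    rw [show p + 1 - e = p - e + 1 by ring] at h1
    rw [show p + 1 - (e + 1) = p - e by ring, show q + (e + 1) = q + e + 1 by ring] at h2
    rw [show p - (e - 1) = p - e + 1 by ring, show q + 1 + (e - 1) = q + e by ring] at h3
    rw [show q + 1 + e = q + e + 1 by ring] at h4
    rw [numUnordered_step_both (by simp only; omega) (by simp only; omega) (by ring) (by omega),
      h1, h2, h3, h4, signedAvoiding_step (p := p) (q := q) (by omega),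
      signedAvoiding_step (p := p - e) (q := q + e) (by omega),
      numPaths_step (p := p) (q := q) (by simp only [ne_eq, Prod.mk.injEq]; omega),
      numPaths_step (p := p - e) (q := q + e) (by simp only [ne_eq, Prod.mk.injEq]; omega)]
    ring

/-- Off the diagonal, a step keeps the sign or lands on the diagonal, where `signedAvoiding`
vanishes and the sign is irrelevant. -/
theorem sign_mul_signedAvoiding_step {p q : ℤ} (h : p + q < 2 * k) (hpq : p ≠ q) :
    (p - q).sign * signedAvoiding k c (p, q) =
      (p + 1 - q).sign * signedAvoiding k c (p + 1, q) +
        (p - (q + 1)).sign * signedAvoiding k c (p, q + 1) := by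
  rw [signedAvoiding_step h]
  rcases lt_or_gt_of_ne hpq with hlt | hlt
  · rw [Int.sign_eq_neg_one_of_neg (by omega), Int.sign_eq_neg_one_of_neg (a := p - (q + 1))
      (by omega)]
    by_cases hp : p + 1 = q
    · rw [hp, signedAvoiding_diag]; ring
    · rw [Int.sign_eq_neg_one_of_neg (by omega)]; ring
  · rw [Int.sign_eq_one_of_pos (by omega), Int.sign_eq_one_of_pos (a := p + 1 - q) (by omega)]
    by_cases hp : p = q + 1
    · rw [hp, signedAvoiding_diag]; ring
    · rw [Int.sign_eq_one_of_pos (by omega)]; ring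

/-- Only the first path moves, starting the induction from the determinant on the antidiagonal of
`(a, a)`. The sum over `i` collects the defects of the recursion for `|signedAvoiding|` at the
diagonal vertices `(a - i, a - i)`. -/
theorem numUnordered_to_diag (hc : 0 < c) {a : ℕ} (ha : (a : ℤ) ≤ k) (t : ℕ) {p q : ℤ}
    (ht : p + q + t = 2 * a) (h0 : 0 ≤ p + q) :
    numUnordered (p, q) (a, a) (k, k) (k + c, k + c) =
      numPaths (a, a) (k, k) * ((p - q).sign * signedAvoiding k c (p, q) +
        ∑ i ∈ Finset.Icc 1 a, numPaths (p, q) (a - i, a - i) *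
          (2 * signedAvoiding k c (a - i + 1, a - i))) := by
  induction t generalizing p q with
  | zero =>
    push_cast at ht
    have hT : (2 * (k - a)).toNat = 2 * (k - a) := by omega
    rw [Finset.sum_eq_zero, add_zero]
    · rcases lt_trichotomy p q with h | h | h
      · have := numUnordered_antidiagonal (c := c) hc (2 * (k - a)).toNat (p := a) (q := a)
          (e := a - p) (k := k) (by omega) (by omega)
        rw [show (a : ℤ) - (a - p) = p by ring, show (a : ℤ) + (a - p) = q by omega,
          signedAvoiding_diag] at this
        rw [numUnordered_comm, this, Int.sign_eq_neg_one_of_neg (by omega)]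
        ring
      · obtain rfl : p = a := by omega
        subst h
        simp [numUnordered_self]
      · have := numUnordered_antidiagonal (c := c) hc (2 * (k - a)).toNat (p := p) (q := q)
          (e := p - a) (k := k) (by omega) (by omega)
        rw [show p - (p - a) = a by ring, show q + (p - a) = a by omega,
          signedAvoiding_diag] at this
        rw [this, Int.sign_eq_one_of_pos (by omega)]
        ring
    · intro i hi
      have := Finset.mem_Icc.1 hi
      rw [numPaths_eq_zero (by omega), zero_mul]
  | succ t ih =>
    push_cast at ht
    rw [numUnordered_step (by simp only; omega) (by simp only; omega) (by omega) (by omega),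
      ih (by omega) (by omega), ih (by omega) (by omega), ← mul_add]
    congr 1
    by_cases hpq : p = q
    · subst hpq
      -- The index `i = a - p` is that of the current vertex `(p, p)`: its term is new, as neither
      -- successor can reach `(p, p)`, and it supplies exactly the defect `2 * signedAvoiding k c (p
      -- + 1, p)`.
      have hmem : (a - p).toNat ∈ Finset.Icc 1 a := by rw [Finset.mem_Icc]; omega
      have hcast : (a : ℤ) - ((a - p).toNat : ℤ) = p := by omega
      have hsum : ∑ i ∈ (Finset.Icc 1 a).erase (a - p).toNat, numPaths (p, p) (a - i, a - i) *
          (2 * signedAvoiding k c (a - i + 1, a - i)) =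
        ∑ i ∈ (Finset.Icc 1 a).erase (a - p).toNat, numPaths (p + 1, p) (a - i, a - i) *
          (2 * signedAvoiding k c (a - i + 1, a - i)) +
        ∑ i ∈ (Finset.Icc 1 a).erase (a - p).toNat, numPaths (p, p + 1) (a - i, a - i) *
          (2 * signedAvoiding k c (a - i + 1, a - i)) := by
        rw [← Finset.sum_add_distrib]
        refine Finset.sum_congr rfl fun i hi => ?_
        have hi' := (Finset.mem_erase.1 hi).1
        rw [numPaths_step (p := p) (q := p) (by simp only [ne_eq, Prod.mk.injEq]; omega), add_mul]
      rw [← Finset.add_sum_erase _ _ hmem, ← Finset.add_sum_erase _ _ hmem,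
        ← Finset.add_sum_erase _ _ hmem, hsum, hcast, numPaths_self,
        numPaths_eq_zero (p := p + 1) (q := p) (p' := p) (by omega),
        numPaths_eq_zero (p := p) (q := p + 1) (p' := p) (by omega), signedAvoiding_diag,
        signedAvoiding_swap k c (p + 1) p, Int.sign_eq_one_of_pos (by omega),
        Int.sign_eq_neg_one_of_neg (by omega)]
      ring
    · have hsum : ∑ i ∈ Finset.Icc 1 a, numPaths (p, q) (a - i, a - i) *
          (2 * signedAvoiding k c (a - i + 1, a - i)) =
        ∑ i ∈ Finset.Icc 1 a, numPaths (p + 1, q) (a - i, a - i) *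
          (2 * signedAvoiding k c (a - i + 1, a - i)) +
        ∑ i ∈ Finset.Icc 1 a, numPaths (p, q + 1) (a - i, a - i) *
          (2 * signedAvoiding k c (a - i + 1, a - i)) := by
        rw [← Finset.sum_add_distrib]
        refine Finset.sum_congr rfl fun i hi => ?_
        rw [numPaths_step (p := p) (q := q) (by simp only [ne_eq, Prod.mk.injEq]; omega), add_mul]
      rw [sign_mul_signedAvoiding_step (by omega) hpq, hsum]
      ring

end Reflection

/-! ### From counts back to weights. -/

section Weights

variable {R : Type*} [CommRing R]

theorem pathWeight_eq (x y : R) {l : List (ℤ × ℤ)} (h : ∀ s ∈ l, s ∈ squareSteps) :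
    pathWeight (squareEdgeWeight x y) l = x ^ l.sum.1.toNat * y ^ l.sum.2.toNat := by
  induction l with
  | nil => simp [pathWeight]
  | cons s l ih =>
    have h1 := fun t ht => h t (List.mem_cons_of_mem _ ht)
    have h2 := h s List.mem_cons_self
    have h3 := sum_nonneg_of_squareSteps h1
    simp only [squareSteps, Finset.mem_insert, Finset.mem_singleton] at h2
    rw [pathWeight, List.map_cons, List.prod_cons, ← pathWeight, ih h1, List.sum_cons]
    rcases h2 with rfl | rfl
    · simp only [Prod.fst_add, Prod.snd_add, zero_add]
      rw [Int.toNat_add (by norm_num) h3.1]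
      simp [squareEdgeWeight, pow_add, mul_assoc]
    · simp only [Prod.fst_add, Prod.snd_add, zero_add]
      rw [Int.toNat_add (by norm_num) h3.2]
      simp [squareEdgeWeight, pow_add, mul_left_comm]

theorem pathWeight_of_mem (x y : R) {p q : ℤ} {n k : ℕ} {l : List (ℤ × ℤ)}
    (h : l ∈ squarePaths (p, q) (p + n, q + k)) :
    pathWeight (squareEdgeWeight x y) l = x ^ n * y ^ k := by
  obtain ⟨h1, h2⟩ := mem_squarePaths.1 h
  rw [Prod.ext_iff] at h2
  simp only [Prod.fst_add, Prod.snd_add, add_right_inj] at h2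
  rw [pathWeight_eq x y h1, h2.1, h2.2, Int.toNat_natCast, Int.toNat_natCast]

theorem wtB_eq (x y : R) (n k : ℕ) :
    wtB x y n k = ((n + k).choose k : R) * x ^ n * y ^ k := by
  have h := numPaths_add 0 0 n k
  simp only [numPaths, zero_add] at h
  rw [wtB, Finset.sum_congr rfl fun l hl =>
    pathWeight_of_mem x y (p := 0) (q := 0) (n := n) (k := k) (by simpa using hl),
    Finset.sum_const, nsmul_eq_mul, mul_assoc]
  rw [Finset.sum_const, nsmul_eq_mul, mul_one] at h
  rw [Nat.cast_injective h]

theorem wtC_eq (x y : R) (n : ℕ) :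
    wtC x y n = (((2 * n).choose n / (n + 1) : ℕ) : R) * x ^ n * y ^ n := by
  have h := numAbove_diag n
  rw [numAbove, Finset.sum_boole] at h
  rw [wtC, Finset.sum_congr rfl fun l hl =>
    pathWeight_of_mem x y (p := 0) (q := 0) (n := n) (k := n)
      (by simpa using (Finset.mem_filter.1 hl).1),
    Finset.sum_const, nsmul_eq_mul, mul_assoc]
  rw [Nat.cast_injective h]

theorem triEdgeWeight_zero (x y : R) : triEdgeWeight x y 0 = squareEdgeWeight x y := by
  ext s
  simp only [triEdgeWeight, squareEdgeWeight, ite_self]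

theorem squarePaths_subset_triPaths (u v : ℤ × ℤ) : squarePaths u v ⊆ triPaths u v := fun l hl => by
  have hs : squareSteps ⊆ triSteps := by decide
  obtain ⟨h1, h2⟩ := mem_squarePaths.1 hl
  exact mem_triPaths.2 ⟨fun s hs' => hs (h1 s hs'), h2⟩

theorem pathWeight_eq_zero (x y : R) {u v : ℤ × ℤ} {l : List (ℤ × ℤ)} (h : l ∈ triPaths u v)
    (h' : l ∉ squarePaths u v) : pathWeight (squareEdgeWeight x y) l = 0 := by
  obtain ⟨h1, h2⟩ := mem_triPaths.1 h
  rw [mem_squarePaths, IsPath, not_and'] at h'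
  have h3 := h' h2
  push Not at h3
  obtain ⟨s, hs, hs'⟩ := h3
  refine List.prod_eq_zero (List.mem_map.2 ⟨s, hs, ?_⟩)
  simp only [squareSteps, Finset.mem_insert, Finset.mem_singleton, not_or] at hs'
  rw [squareEdgeWeight, if_neg hs'.1, if_neg hs'.2]

/-- A family on the triangular lattice but not on the square lattice contains a diagonal edge, hence
a factor `z = 0`. -/
theorem nonIntersectingWeight_square_eq_tri (x y : R) {n : ℕ} (u v : Fin n → ℤ × ℤ) :
    nonIntersectingWeight squarePaths (squareEdgeWeight x y) u v =
      nonIntersectingWeight triPaths (triEdgeWeight x y 0) u v := by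
  rw [triEdgeWeight_zero]
  refine Finset.sum_congr rfl fun π _ => Finset.sum_subset ?_ ?_
  · exact Finset.filter_subset_filter _ (Fintype.piFinset_subset _ _ fun i =>
      squarePaths_subset_triPaths _ _)
  · intro p hp hp'
    simp only [nonIntersecting, Finset.mem_filter, Fintype.mem_piFinset] at hp hp'
    have h3 := fun h => hp' ⟨h, hp.2⟩
    rw [imp_false] at h3
    push Not at h3
    obtain ⟨i, hi⟩ := h3
    exact Finset.prod_eq_zero (Finset.mem_univ i) (pathWeight_eq_zero x y (hp.1 i) hi)

theorem card_nonIntersecting (u v : Fin 2 → ℤ × ℤ) (π : Equiv.Perm (Fin 2)) :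
    ((nonIntersecting squarePaths u v π).card : ℤ) =
      numPairs (u 0) (u 1) (v (π 0)) (v (π 1)) := by
  rw [numPairs, ← Finset.sum_product', Finset.sum_boole, Nat.cast_inj]
  refine Finset.card_equiv (finTwoArrowEquiv _) fun p => ?_
  simp only [nonIntersecting, Finset.mem_filter, Fintype.mem_piFinset, Fin.forall_fin_two,
    Finset.mem_product, finTwoArrowEquiv_apply]
  refine and_congr_right fun _ => ?_
  constructor
  · intro h
    exact h.1.2 (by decide)
  · intro h
    exact ⟨⟨fun h' => absurd rfl h', fun _ => h⟩, fun _ q hq hq' => h q hq' hq,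
      fun h' => absurd rfl h'⟩

theorem squarePairsWeight_eq (x y : R) (a b c : ℕ) :
    squarePairsWeight x y a b c =
      (numUnordered (0, 0) (a, a) ((a : ℤ) + b, (a : ℤ) + b)
        ((a : ℤ) + b + c, (a : ℤ) + b + c) : R) * (x * y) ^ (a + 2 * b + c) := by
  have key (π : Equiv.Perm (Fin 2)) :
      ∑ p ∈ nonIntersecting squarePaths (startPoints a) (endPoints a b c) π,
        ∏ i, pathWeight (squareEdgeWeight x y) (p i) =
      (numPairs (startPoints a 0) (startPoints a 1) (endPoints a b c (π 0))
        (endPoints a b c (π 1)) : R) * (x * y) ^ (a + 2 * b + c) := by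
    rw [← card_nonIntersecting, Int.cast_natCast, ← nsmul_eq_mul, ← Finset.sum_const]
    refine Finset.sum_congr rfl fun p hp => ?_
    simp only [nonIntersecting, Finset.mem_filter, Fintype.mem_piFinset, Fin.forall_fin_two] at hp
    obtain ⟨⟨h0, h1⟩, -⟩ := hp
    rw [Fin.prod_univ_two]
    obtain rfl | rfl : π = 1 ∨ π = Equiv.swap 0 1 :=
      (by decide : ∀ π : Equiv.Perm (Fin 2), π = 1 ∨ π = Equiv.swap 0 1) π
    · rw [pathWeight_of_mem x y (p := 0) (q := 0) (n := a + b) (k := a + b)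
          (by simpa [startPoints, endPoints] using h0),
        pathWeight_of_mem x y (p := a) (q := a) (n := b + c) (k := b + c)
          (by simpa [startPoints, endPoints, add_assoc] using h1)]
      ring
    · rw [pathWeight_of_mem x y (p := 0) (q := 0) (n := a + b + c) (k := a + b + c)
          (by simpa [startPoints, endPoints] using h0),
        pathWeight_of_mem x y (p := a) (q := a) (n := b) (k := b)
          (by simpa [startPoints, endPoints] using h1)]
      ring
  have hu : (Finset.univ : Finset (Equiv.Perm (Fin 2))) = {1, Equiv.swap 0 1} := by decide
  rw [squarePairsWeight, nonIntersectingWeight, Finset.sum_congr rfl fun π _ => key π, hu,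
    Finset.sum_pair (by decide), ← add_mul, ← Int.cast_add]
  rfl

/-- The number of pairs of paths without a common vertex. -/
theorem numUnordered_eq (a b c : ℕ) (hc : 0 < c) :
    numUnordered (0, 0) (a, a) ((a : ℤ) + b, (a : ℤ) + b)
        ((a : ℤ) + b + c, (a : ℤ) + b + c) =
      2 * (b + b).choose b * ∑ i ∈ Finset.Icc 1 a, ∑ j ∈ Finset.Icc 1 c,
        ((2 * (b + i + j - 1)).choose (b + i + j - 1) / (b + i + j - 1 + 1) : ℕ) *
          ((a - i + (a - i)).choose (a - i) : ℤ) * ((c - j + (c - j)).choose (c - j) : ℤ) := by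
  rw [numUnordered_to_diag hc (by omega) (2 * a) (by push_cast; ring) (by norm_num), numPaths_add,
    signedAvoiding_diag, mul_zero, zero_add, mul_comm 2, mul_assoc]
  congr 1
  rw [Finset.mul_sum]
  refine Finset.sum_congr rfl fun i hi => ?_
  obtain ⟨hi1, hi2⟩ := Finset.mem_Icc.1 hi
  have hn := numPaths_add 0 0 (a - i) (a - i)
  simp only [zero_add, Nat.cast_sub hi2] at hn
  rw [hn, signedAvoiding, Finset.mul_sum, Finset.mul_sum, Finset.mul_sum]
  refine Finset.sum_congr rfl fun j hj => ?_
  obtain ⟨hj1, hj2⟩ := Finset.mem_Icc.1 hj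
  have hf := signedFirstHit_catalan (a - i) (b + i + j - 1)
  -- The excursion from `(a - i, a - i)` to `(a + b + j, a + b + j)` has semilength `b + i + j`,
  -- whence the Catalan index `b + i + j - 1`.
  rw [show (a : ℤ) - i + (b + i + j - 1 : ℕ) + 1 = a + b + j by omega] at hf
  have hm := numPaths_add (a + b + j) (a + b + j) (c - j) (c - j)
  rw [show (a : ℤ) + b + j + (c - j : ℕ) = a + b + c by omega] at hm
  rw [hf, hm]
  push_cast
  ring

end Weights

end LatticePaths

theorem mainTheorem5 {R : Type*} [CommRing R] (x y : R) :
    (∀ a b c : ℕ, 0 < a → 0 < c →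
      LatticePaths.squarePairsWeight x y a b c = LatticePaths.triPairsWeight x y 0 a b c ∧
      LatticePaths.squarePairsWeight x y a b c =
        2 * (x * y) * LatticePaths.wtB x y b b *
          ∑ i ∈ Finset.Icc 1 a, ∑ j ∈ Finset.Icc 1 c,
            LatticePaths.wtC x y (b + i + j - 1) *
              LatticePaths.wtB x y (a - i) (a - i) * LatticePaths.wtB x y (c - j) (c - j)) ∧
    (∀ n k : ℕ, LatticePaths.wtB x y n k = ((n + k).choose k : R) * x ^ n * y ^ k) ∧
    (∀ n : ℕ, LatticePaths.wtC x y n = (((2 * n).choose n / (n + 1) : ℕ) : R) * x ^ n * y ^ n) := by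
  refine ⟨fun a b c _ hc => ⟨LatticePaths.nonIntersectingWeight_square_eq_tri x y _ _, ?_⟩,
    LatticePaths.wtB_eq x y, LatticePaths.wtC_eq x y⟩
  rw [LatticePaths.squarePairsWeight_eq, LatticePaths.numUnordered_eq a b c hc]
  simp only [Int.cast_mul, Int.cast_sum, Int.cast_natCast, Int.cast_ofNat, Finset.mul_sum,
    Finset.sum_mul]
  refine Finset.sum_congr rfl fun i hi => Finset.sum_congr rfl fun j hj => ?_
  obtain ⟨hi1, hi2⟩ := Finset.mem_Icc.1 hi
  obtain ⟨hj1, hj2⟩ := Finset.mem_Icc.1 hj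
  simp only [LatticePaths.wtB_eq, LatticePaths.wtC_eq]
  -- The lone factor `x * y` is the weight of the first and last edges of the excursion, which the
  -- Catalan factor omits.
  have hpow : (x * y) ^ (a + 2 * b + c) = (x * y) * (x * y) ^ b * (x * y) ^ (b + i + j - 1) *
      (x * y) ^ (a - i) * (x * y) ^ (c - j) := by
    rw [← pow_succ', ← pow_add, ← pow_add, ← pow_add]
    congr 1
    omega
  rw [hpow]
  simp only [mul_pow]
  ring
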